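/- Let $q\in\mathbb C$ with $|q|<1$. For $a,p\in\mathbb C$ with $|p|<1$ put $(a;p)_\infty=\prod_{k=0}^{\infty}(1-ap^k)$ and $(a_1,\dots,a_m;p)_\infty=\prod_{i=1}^m(a_i;p)_\infty$, and for $n\in\mathbb Z$ let $\binom n2=\frac{n(n-1)}2$. Then the bilateral series below converges absolutely and $$6\sum_{n=-\infty}^{\infty} n\,q^{3\binom n2+2n}=(q;q)_\infty^3\,(q;q^2)_\infty^2-(-q,-q^2,q^3;q^3)_\infty .$$ -/

import Mathlib

/-- The infinite `q`-shifted factorial `(a; q)_∞ = ∏_{k ≥ 0} (1 - a q^k)`. -/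
noncomputable def qFactorialInf (a q : ℂ) : ℂ :=
  ∏' k : ℕ, (1 - a * q ^ k)

/-- The multi-factorial `(a_1, …, a_m; q)_∞ = ∏_i (a_i; q)_∞`. -/
noncomputable def qMultiFactorialInf {m : ℕ} (a : Fin m → ℂ) (q : ℂ) : ℂ :=
  ∏ i : Fin m, qFactorialInf (a i) q

/-- For `|q| < 1` the infinite product defining `(a; q)_∞` converges (absolutely),
so `qFactorialInf` is never a default value there. -/
theorem multipliable_qFactorialInf (a : ℂ) {q : ℂ} (hq : ‖q‖ < 1) :
    Multipliable (fun k : ℕ => 1 - a * q ^ k) := by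
  have h : Summable (fun k : ℕ => ‖-(a * q ^ k)‖) := by
    simpa [norm_mul, norm_pow] using
      (summable_geometric_of_lt_one (norm_nonneg q) hq).mul_left ‖a‖
  simpa [sub_eq_add_neg] using multipliable_one_add_of_summable h

/-!
The identity combines two evaluations.

The first is `∑ (6 n + 1) q ^ (n (3 n + 1) / 2) = (q; q)_∞ ^ 3 (q; q²)_∞ ^ 2`
(`tsum_six_mul_add_one_mul_zpow`), the derivative at `z = 1` of the quintuple product identity.
Multiply the theta series `∑ (-1)^n q^(n(n-1)/2) z^n` and `∑ (-1)^m q^(m²) z^(2m)` and differentiate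
at `z = 1`. The first series vanishes there, and its derivative is `-(q; q)_∞ ^ 3` by Jacobi's
identity `tsum_mul_thetaTerm_one`; the second is a Jacobi triple product (`tsum_thetaTerm`). On the
other side, collect the double series by powers `z^k`. Completing the square in the exponents shows
that the coefficient of `z^k` is `0` when `k ≡ 2` modulo `3`, and for `k = -3 l` and `k = 3 l + 1`
it is `± q^(l(3l+1)/2)` times the same theta value, which the triple product identifies as
`(q²; q²)_∞`. Cancelling this nonzero factor leaves the claim.

The second is `∑ q ^ (n (3 n + 1) / 2) = (-q, -q², q³; q³)_∞`, again a Jacobi triple product.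
Subtracting the two gives the theorem.

The triple product and Jacobi's identity come from a finite version with `q`-binomial coefficients
(`hasSum_centralQBinom_mul_thetaTerm`) and its derivative at `z = 1`
(`hasSum_mul_centralQBinom_mul_thetaTerm`), both by induction on the number of factors, and a passage
to the limit by dominated convergence (`tendsto_tsum_centralQBinom_mul`). This argument divides by
`q`, so `q = 0` is treated separately; there both sides are `0`.
-/

open Filter Topology

/-! ### Finite and infinite shifted factorials -/

/-- The finite `q`-shifted factorial `(a; q)_n = ∏_{k < n} (1 - a q^k)`. -/
noncomputable def qFactorialFin (a q : ℂ) (n : ℕ) : ℂ :=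
  ∏ k ∈ Finset.range n, (1 - a * q ^ k)

/-- The reciprocal `1 / (q; q)_n`, extended by `0` to negative `n`, which is the extension that
keeps the recurrence `qFactorialRecip_sub_one` valid for all integers. -/
noncomputable def qFactorialRecip (q : ℂ) (n : ℤ) : ℂ :=
  if 0 ≤ n then (qFactorialFin q q n.toNat)⁻¹ else 0

/-- The general term `(-1)^n q^(n(n-1)/2) z^n` of the theta series in the Jacobi triple product. -/
noncomputable def thetaTerm (q z : ℂ) (n : ℤ) : ℂ :=
  (-1) ^ n * q ^ Ring.choose n 2 * z ^ n

/-- The `q`-binomial coefficient `(q; q)_{M+N} / ((q; q)_{M-n} (q; q)_{N+n})`, which vanishes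
unless `-N ≤ n ≤ M`. -/
noncomputable def centralQBinom (q : ℂ) (M N : ℕ) (n : ℤ) : ℂ :=
  qFactorialFin q q (M + N) * qFactorialRecip q (M - n) * qFactorialRecip q (N + n)

lemma qFactorialFin_succ (a q : ℂ) (n : ℕ) :
    qFactorialFin a q (n + 1) = qFactorialFin a q n * (1 - a * q ^ n) :=
  Finset.prod_range_succ _ _

@[simp] lemma qFactorialFin_zero (a q : ℂ) : qFactorialFin a q 0 = 1 := by
  simp [qFactorialFin]

lemma tendsto_qFactorialFin (a : ℂ) {q : ℂ} (hq : ‖q‖ < 1) :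
    Tendsto (qFactorialFin a q) atTop (𝓝 (qFactorialInf a q)) :=
  (multipliable_qFactorialInf a hq).hasProd.tendsto_prod_nat

lemma one_sub_mul_pow_ne_zero {a q : ℂ} (ha : ‖a‖ < 1) (hq : ‖q‖ < 1) (n : ℕ) :
    1 - a * q ^ n ≠ 0 := by
  intro h
  have h1 : ‖a * q ^ n‖ < 1 := by
    rw [norm_mul, norm_pow]
    calc ‖a‖ * ‖q‖ ^ n ≤ ‖a‖ * 1 := by
          gcongr; exact pow_le_one₀ (norm_nonneg _) hq.le
      _ < 1 := by simpa
  rw [← sub_eq_zero.mp h] at h1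
  simp at h1

lemma qFactorialFin_ne_zero {a q : ℂ} (ha : ‖a‖ < 1) (hq : ‖q‖ < 1) (n : ℕ) :
    qFactorialFin a q n ≠ 0 :=
  Finset.prod_ne_zero_iff.mpr fun k _ => one_sub_mul_pow_ne_zero ha hq k

lemma qFactorialInf_ne_zero {a q : ℂ} (ha : ‖a‖ < 1) (hq : ‖q‖ < 1) :
    qFactorialInf a q ≠ 0 := by
  have h : Summable (fun k : ℕ => ‖-(a * q ^ k)‖) := by
    simpa [norm_mul, norm_pow] using
      (summable_geometric_of_lt_one (norm_nonneg q) hq).mul_left ‖a‖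
  have := tprod_one_add_ne_zero_of_summable (f := fun k : ℕ => -(a * q ^ k))
    (fun k => by simpa [sub_eq_add_neg] using one_sub_mul_pow_ne_zero ha hq k) h
  simpa [qFactorialInf, sub_eq_add_neg] using this

lemma qFactorialRecip_sub_one {q : ℂ} (hq : ‖q‖ < 1) (n : ℤ) :
    qFactorialRecip q (n - 1) = (1 - q ^ n) * qFactorialRecip q n := by
  rcases lt_trichotomy n 0 with h | rfl | h
  · simp [qFactorialRecip, h.not_ge, show ¬ (1 ≤ n) by lia]
  · simp [qFactorialRecip]
  · obtain ⟨k, rfl⟩ : ∃ k : ℕ, n = k + 1 := ⟨(n - 1).toNat, by lia⟩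
    have h1 : (0 : ℤ) ≤ (k : ℤ) + 1 := by lia
    have h2 := one_sub_mul_pow_ne_zero hq hq k
    have h3 := qFactorialFin_ne_zero hq hq k
    have h4 : q ^ ((k : ℤ) + 1) = q * q ^ k := by
      rw [← pow_succ']; exact_mod_cast zpow_natCast q (k + 1)
    simp only [qFactorialRecip, h1, if_true, add_sub_cancel_right, Int.natCast_nonneg,
      Int.toNat_natCast, Int.toNat_natCast_add_one, qFactorialFin_succ, h4]
    field_simp

/-! ### The finite triple product -/

lemma choose_two_succ (n : ℤ) : Ring.choose (n + 1) 2 = Ring.choose n 2 + n := by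
  rw [Ring.choose_succ_succ n 1, Ring.choose_one_right, add_comm]

lemma two_mul_choose_two (n : ℤ) : 2 * Ring.choose n 2 = n * (n - 1) := by
  induction n using Int.induction_on with
  | zero => rw [Ring.choose_zero_pos ℤ (by norm_num)]; simp
  | succ n ih => rw [choose_two_succ]; linarith
  | pred n ih =>
    have h := choose_two_succ (-n - 1)
    rw [sub_add_cancel] at h
    rw [h] at ih
    linarith

lemma HasSum.congr_of_eq {ι : Type*} {f g : ι → ℂ} {a b : ℂ} (h : HasSum f a)
    (hfg : ∀ n, g n = f n) (hab : b = a) : HasSum g b := by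
  rw [hab, funext hfg]; exact h

lemma thetaTerm_succ {q z : ℂ} (hq : q ≠ 0) (hz : z ≠ 0) (n : ℤ) :
    thetaTerm q z (n + 1) = -(z * q ^ n) * thetaTerm q z n := by
  simp only [thetaTerm, choose_two_succ, zpow_add₀ hq, zpow_add₀ hz,
    zpow_add₀ (neg_ne_zero.mpr (one_ne_zero (α := ℂ))), zpow_one]
  ring

lemma centralQBinom_succ_left {q z : ℂ} (hq : ‖q‖ < 1) (hq0 : q ≠ 0) (hz : z ≠ 0)
    (M N : ℕ) (n : ℤ) :
    centralQBinom q (M + 1) N n * thetaTerm q z n =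
      centralQBinom q M N n * thetaTerm q z n -
        z * q ^ M * (centralQBinom q M N (n - 1) * thetaTerm q z (n - 1)) := by
  have h1 := qFactorialRecip_sub_one hq ((M : ℤ) + 1 - n)
  have h2 := qFactorialRecip_sub_one hq ((N : ℤ) + n)
  have h3 := thetaTerm_succ hq0 hz (n - 1)
  have h4 : q ^ ((M : ℤ) + 1 - n) * q ^ ((N : ℤ) + n) = q * q ^ (M + N) := by
    rw [← zpow_add₀ hq0, ← pow_succ', ← zpow_natCast]; congr 1; push_cast; ring
  have h5 : q ^ ((M : ℤ) + 1 - n) * q ^ (n - 1) = q ^ M := by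
    rw [← zpow_add₀ hq0, ← zpow_natCast]; congr 1; ring
  rw [show (M : ℤ) + 1 - n - 1 = M - n by ring] at h1
  rw [show (N : ℤ) + n - 1 = N + (n - 1) by ring] at h2
  rw [sub_add_cancel] at h3
  simp only [centralQBinom, Nat.cast_add, Nat.cast_one, add_right_comm M 1 N,
    qFactorialFin_succ, show (M : ℤ) - (n - 1) = M + 1 - n by ring, h1, h2, h3, ← h4, ← h5]
  ring

lemma centralQBinom_succ_right {q z : ℂ} (hq : ‖q‖ < 1) (hq0 : q ≠ 0) (hz : z ≠ 0)
    (M N : ℕ) (n : ℤ) :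
    centralQBinom q M (N + 1) n * thetaTerm q z n =
      centralQBinom q M N n * thetaTerm q z n -
        q / z * q ^ N * (centralQBinom q M N (n + 1) * thetaTerm q z (n + 1)) := by
  have h1 := qFactorialRecip_sub_one hq ((M : ℤ) - n)
  have h2 := qFactorialRecip_sub_one hq ((N : ℤ) + n + 1)
  have h3 := thetaTerm_succ hq0 hz n
  have h4 : q ^ ((M : ℤ) - n) * q ^ ((N : ℤ) + n + 1) = q * q ^ (M + N) := by
    rw [← zpow_add₀ hq0, ← pow_succ', ← zpow_natCast]; congr 1; push_cast; ring
  have h5 : q ^ ((N : ℤ) + n + 1) = q * q ^ N * q ^ n := by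
    rw [zpow_add₀ hq0, zpow_add₀ hq0, zpow_natCast, zpow_one]; ring
  rw [show (N : ℤ) + n + 1 - 1 = N + n by ring] at h2
  simp only [centralQBinom, Nat.cast_add, Nat.cast_one, ← add_assoc M N 1,
    qFactorialFin_succ, show (N : ℤ) + (n + 1) = N + n + 1 by ring,
    show (N : ℤ) + 1 + n = N + n + 1 by ring,
    show (M : ℤ) - (n + 1) = M - n - 1 by ring, h1, h2, h3, ← h4]
  rw [h5]
  field_simp
  ring

lemma centralQBinom_zero_zero (q : ℂ) (n : ℤ) :
    centralQBinom q 0 0 n = if n = 0 then 1 else 0 := by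
  rcases lt_trichotomy n 0 with h | rfl | h
  · simp [centralQBinom, qFactorialRecip, h.not_ge, h.ne]
  · simp [centralQBinom, qFactorialRecip]
  · simp [centralQBinom, qFactorialRecip, h.not_ge, h.ne']

/-- The finite form of the Jacobi triple product identity. -/
lemma hasSum_centralQBinom_mul_thetaTerm {q z : ℂ} (hq : ‖q‖ < 1) (hq0 : q ≠ 0) (hz : z ≠ 0)
    (M N : ℕ) :
    HasSum (fun n : ℤ => centralQBinom q M N n * thetaTerm q z n)
      (qFactorialFin z q M * qFactorialFin (q / z) q N) := by
  induction M with
  | zero =>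
    induction N with
    | zero =>
      refine (hasSum_ite_eq (0 : ℤ) (1 : ℂ)).congr_of_eq (fun n => ?_) (by simp)
      by_cases h : n = 0
      · simp [centralQBinom_zero_zero, h, thetaTerm, Ring.choose_zero_pos ℤ]
      · simp [centralQBinom_zero_zero, h]
    | succ N ih =>
      have h := ih.sub ((((Equiv.addRight (1 : ℤ)).hasSum_iff.mpr ih)).mul_left (q / z * q ^ N))
      refine h.congr_of_eq (fun n => ?_) ?_
      · rw [centralQBinom_succ_right hq hq0 hz]; rfl
      · rw [qFactorialFin_succ]; ring
  | succ M ih =>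
    have h := ih.sub ((((Equiv.subRight (1 : ℤ)).hasSum_iff.mpr ih)).mul_left (z * q ^ M))
    refine h.congr_of_eq (fun n => ?_) ?_
    · rw [centralQBinom_succ_left hq hq0 hz]; rfl
    · rw [qFactorialFin_succ]; ring

/-- The derivative at `z = 1` of the finite Jacobi triple product identity. -/
lemma hasSum_mul_centralQBinom_mul_thetaTerm {q : ℂ} (hq : ‖q‖ < 1) (hq0 : q ≠ 0) (M N : ℕ) :
    HasSum (fun n : ℤ => (n : ℂ) * (centralQBinom q (M + 1) N n * thetaTerm q 1 n))
      (-(qFactorialFin q q M * qFactorialFin q q N)) := by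
  have key (M N : ℕ) := hasSum_centralQBinom_mul_thetaTerm hq hq0 one_ne_zero M N
  -- The product rule for the new factor `1 - z q^M`, evaluated at `z = 1`.
  have stepLeft (M N : ℕ) (D : ℂ)
      (hD : HasSum (fun n : ℤ => (n : ℂ) * (centralQBinom q M N n * thetaTerm q 1 n)) D) :
      HasSum (fun n : ℤ => (n : ℂ) * (centralQBinom q (M + 1) N n * thetaTerm q 1 n))
        (D - q ^ M * (D + qFactorialFin 1 q M * qFactorialFin q q N)) := by
    have h1 := (Equiv.subRight (1 : ℤ)).hasSum_iff.mpr (hD.add (key M N))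
    have h := hD.sub (h1.mul_left (q ^ M))
    refine h.congr_of_eq (fun n => ?_) ?_
    · rw [centralQBinom_succ_left hq hq0 one_ne_zero]
      simp only [Function.comp, Equiv.subRight_apply]
      push_cast
      ring
    · simp
  have one_fin (M : ℕ) : qFactorialFin 1 q (M + 1) = 0 := by
    simp [qFactorialFin, Finset.prod_range_succ']
  induction M with
  | zero =>
    induction N with
    | zero =>
      have h0 : HasSum (fun n : ℤ => (n : ℂ) * (centralQBinom q 0 0 n * thetaTerm q 1 n)) 0 := by
        refine hasSum_zero.congr_of_eq (fun n => ?_) rfl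
        by_cases h : n = 0 <;> simp [centralQBinom_zero_zero, h]
      simpa using stepLeft 0 0 0 h0
    | succ N ih =>
      have h1 := (Equiv.addRight (1 : ℤ)).hasSum_iff.mpr (ih.sub (key (0 + 1) N))
      have h := ih.sub (h1.mul_left (q * q ^ N))
      refine h.congr_of_eq (fun n => ?_) ?_
      · rw [centralQBinom_succ_right hq hq0 one_ne_zero]
        simp only [Function.comp, Equiv.coe_addRight]
        push_cast
        ring
      · rw [one_fin, qFactorialFin_succ]; ring
  | succ M ih =>
    refine (stepLeft (M + 1) N _ ih).congr_of_eq (fun n => rfl) ?_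
    rw [one_fin, qFactorialFin_succ]; ring

/-! ### Convergence of theta series -/

/-- The half series `∑_{n ≥ 0} ρ^(n(n-1)/2) w^n` converges by the ratio test. -/
lemma summable_pow_choose_two_mul_pow {ρ w : ℝ} (h0 : 0 < ρ) (h1 : ρ < 1) (hw : 0 < w) :
    Summable (fun n : ℕ => ρ ^ Ring.choose (n : ℤ) 2 * w ^ n) := by
  refine summable_of_ratio_test_tendsto_lt_one (l := 0) one_pos
    (Eventually.of_forall fun n => by positivity) ?_
  have h : Tendsto (fun n : ℕ => ρ ^ n * w) atTop (𝓝 0) := by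
    simpa using (tendsto_pow_atTop_nhds_zero_of_lt_one h0.le h1).mul_const w
  refine h.congr fun n => ?_
  have h2 : (0 : ℝ) < ρ ^ Ring.choose (n : ℤ) 2 := by positivity
  rw [Real.norm_of_nonneg (by positivity), Real.norm_of_nonneg (by positivity)]
  push_cast
  rw [choose_two_succ, zpow_add₀ h0.ne', pow_succ, zpow_natCast]
  field_simp

lemma choose_two_neg (n : ℤ) : Ring.choose (-n) 2 = Ring.choose n 2 + n := by
  have h1 := two_mul_choose_two n
  have h2 := two_mul_choose_two (-n)
  linarith

lemma summable_zpow_choose_two_mul_zpow {ρ w : ℝ} (h0 : 0 < ρ) (h1 : ρ < 1) (hw : 0 < w) :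
    Summable (fun n : ℤ => ρ ^ Ring.choose n 2 * w ^ n) := by
  refine Summable.of_nat_of_neg (by simpa using summable_pow_choose_two_mul_pow h0 h1 hw) ?_
  refine (summable_pow_choose_two_mul_pow h0 h1 (div_pos h0 hw)).congr fun n => ?_
  rw [choose_two_neg, zpow_add₀ h0.ne', zpow_neg, div_pow, zpow_natCast, zpow_natCast]
  field_simp

lemma abs_le_two_zpow_add (n : ℤ) : |(n : ℝ)| ≤ 2 ^ n + 2⁻¹ ^ n := by
  have key (k : ℕ) : (k : ℝ) ≤ 2 ^ k := by exact_mod_cast Nat.lt_two_pow_self.le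
  have hp : (0 : ℝ) < 2 ^ n := by positivity
  have hp' : (0 : ℝ) < 2⁻¹ ^ n := by positivity
  rcases Int.eq_nat_or_neg n with ⟨k, rfl | rfl⟩
  · have := key k
    simp only [zpow_natCast, Int.cast_natCast, Nat.abs_cast] at *
    linarith
  · have := key k
    simp only [inv_zpow', neg_neg, zpow_natCast, Int.cast_neg, Int.cast_natCast, abs_neg,
      Nat.abs_cast] at *
    linarith

lemma norm_thetaTerm (q z : ℂ) (n : ℤ) :
    ‖thetaTerm q z n‖ = ‖q‖ ^ Ring.choose n 2 * ‖z‖ ^ n := by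
  simp [thetaTerm]

lemma summable_norm_thetaTerm {q z : ℂ} (hq : ‖q‖ < 1) (hq0 : q ≠ 0) (hz : z ≠ 0) :
    Summable (fun n : ℤ => ‖thetaTerm q z n‖) := by
  simp only [norm_thetaTerm]
  exact summable_zpow_choose_two_mul_zpow (norm_pos_iff.mpr hq0) hq (norm_pos_iff.mpr hz)

lemma summable_norm_mul_thetaTerm {q z : ℂ} (hq : ‖q‖ < 1) (hq0 : q ≠ 0) (hz : z ≠ 0) :
    Summable (fun n : ℤ => ‖(n : ℂ) * thetaTerm q z n‖) := by
  have hq' := norm_pos_iff.mpr hq0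
  have hz' := norm_pos_iff.mpr hz
  -- The factor `n` is absorbed by replacing `z` with `2 z` and `z / 2`.
  refine Summable.of_nonneg_of_le (fun n => norm_nonneg _) (fun n => ?_)
    ((summable_zpow_choose_two_mul_zpow hq' hq (mul_pos two_pos hz')).add
      (summable_zpow_choose_two_mul_zpow hq' hq (mul_pos (inv_pos.mpr two_pos) hz')))
  have hp : 0 ≤ ‖q‖ ^ Ring.choose n 2 * ‖z‖ ^ n := by positivity
  rw [norm_mul, norm_thetaTerm, Complex.norm_intCast, mul_zpow, mul_zpow]
  nlinarith [mul_le_mul_of_nonneg_right (abs_le_two_zpow_add n) hp]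

/-! ### The Jacobi triple product -/

lemma tendsto_qFactorialRecip {q : ℂ} (hq : ‖q‖ < 1) :
    Tendsto (qFactorialRecip q) atTop (𝓝 (qFactorialInf q q)⁻¹) := by
  have h1 : Tendsto Int.toNat atTop atTop :=
    tendsto_atTop.mpr fun b => (eventually_ge_atTop (b : ℤ)).mono fun n hn => by lia
  have h := ((tendsto_qFactorialFin q hq).inv₀ (qFactorialInf_ne_zero hq hq)).comp h1
  refine h.congr' ((eventually_ge_atTop 0).mono fun n hn => ?_)
  simp [qFactorialRecip, hn]

lemma exists_norm_qFactorialRecip_le {q : ℂ} (hq : ‖q‖ < 1) :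
    ∃ B, 0 ≤ B ∧ ∀ n, ‖qFactorialRecip q n‖ ≤ B := by
  obtain ⟨B, hB⟩ :=
    ((tendsto_qFactorialFin q hq).inv₀ (qFactorialInf_ne_zero hq hq)).norm.bddAbove_range
  have hB' (n : ℕ) : ‖(qFactorialFin q q n)⁻¹‖ ≤ B := hB ⟨n, rfl⟩
  have h0 : 0 ≤ B := (norm_nonneg _).trans (hB' 0)
  refine ⟨B, h0, fun n => ?_⟩
  unfold qFactorialRecip
  split_ifs
  · exact hB' _
  · simpa using h0

/-- Tannery's theorem for the `q`-binomial coefficients: each of them tends to `1 / (q; q)_∞`, and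
they are uniformly bounded. -/
lemma tendsto_tsum_centralQBinom_mul {q : ℂ} (hq : ‖q‖ < 1) {u : ℤ → ℂ}
    (hu : Summable (fun n => ‖u n‖)) :
    Tendsto (fun N : ℕ => ∑' n, centralQBinom q (N + 1) N n * u n) atTop
      (𝓝 ((qFactorialInf q q)⁻¹ * ∑' n, u n)) := by
  have hne := qFactorialInf_ne_zero hq hq
  obtain ⟨B, hB0, hB⟩ := exists_norm_qFactorialRecip_le hq
  obtain ⟨A, hA⟩ := (tendsto_qFactorialFin q hq).norm.bddAbove_range
  have hA' (n : ℕ) : ‖qFactorialFin q q n‖ ≤ A := hA ⟨n, rfl⟩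
  have hA0 : 0 ≤ A := (norm_nonneg _).trans (hA' 0)
  rw [← tsum_mul_left]
  refine tendsto_tsum_of_dominated_convergence (hu.mul_left (A * B * B)) (fun n => ?_)
    (Eventually.of_forall fun N n => ?_)
  · have h1 : Tendsto (fun N : ℕ => N + 1 + N) atTop atTop :=
      tendsto_atTop_mono (fun N => Nat.le_add_left _ _) tendsto_id
    have h2 : Tendsto (fun N : ℕ => ((N + 1 : ℕ) : ℤ) - n) atTop atTop :=
      tendsto_atTop.mpr fun b =>
        (eventually_ge_atTop (b + n).toNat).mono fun N hN => by lia
    have h3 : Tendsto (fun N : ℕ => (N : ℤ) + n) atTop atTop :=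
      tendsto_atTop.mpr fun b =>
        (eventually_ge_atTop (b - n).toNat).mono fun N hN => by lia
    have h := ((((tendsto_qFactorialFin q hq).comp h1).mul
      ((tendsto_qFactorialRecip hq).comp h2)).mul
      ((tendsto_qFactorialRecip hq).comp h3)).mul_const (u n)
    rw [mul_inv_cancel₀ hne, one_mul] at h
    exact h
  · rw [norm_mul, centralQBinom, norm_mul, norm_mul]
    gcongr
    exacts [hA' _, hB _, hB _]

/-- The Jacobi triple product identity. -/
theorem tsum_thetaTerm {q z : ℂ} (hq : ‖q‖ < 1) (hq0 : q ≠ 0) (hz : z ≠ 0) :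
    ∑' n, thetaTerm q z n = qFactorialInf q q * qFactorialInf z q * qFactorialInf (q / z) q := by
  have h1 := tendsto_tsum_centralQBinom_mul hq (summable_norm_thetaTerm hq hq0 hz)
  simp only [(hasSum_centralQBinom_mul_thetaTerm hq hq0 hz _ _).tsum_eq] at h1
  have h2 := ((tendsto_qFactorialFin z hq).comp (tendsto_add_atTop_nat 1)).mul
    (tendsto_qFactorialFin (q / z) hq)
  have h := tendsto_nhds_unique h1 h2
  rw [inv_mul_eq_iff_eq_mul₀ (qFactorialInf_ne_zero hq hq)] at h
  rw [h, mul_assoc]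

/-- Jacobi's identity for the cube of `(q; q)_∞`. -/
theorem tsum_mul_thetaTerm_one {q : ℂ} (hq : ‖q‖ < 1) (hq0 : q ≠ 0) :
    ∑' n : ℤ, (n : ℂ) * thetaTerm q 1 n = -qFactorialInf q q ^ 3 := by
  have h1 := tendsto_tsum_centralQBinom_mul hq (summable_norm_mul_thetaTerm hq hq0 one_ne_zero)
  simp only [mul_left_comm (centralQBinom _ _ _ _),
    (hasSum_mul_centralQBinom_mul_thetaTerm hq hq0 _ _).tsum_eq] at h1
  have h2 := ((tendsto_qFactorialFin q hq).mul (tendsto_qFactorialFin q hq)).neg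
  have h := tendsto_nhds_unique h1 h2
  rw [inv_mul_eq_iff_eq_mul₀ (qFactorialInf_ne_zero hq hq)] at h
  rw [h]; ring

lemma tsum_thetaTerm_one {q : ℂ} (hq : ‖q‖ < 1) (hq0 : q ≠ 0) :
    ∑' n : ℤ, thetaTerm q 1 n = 0 := by
  have h : qFactorialInf 1 q = 0 :=
    tprod_of_exists_eq_zero ⟨0, by simp⟩
  rw [tsum_thetaTerm hq hq0 one_ne_zero, h]; simp

/-! ### Quadratic exponents -/

lemma thetaTerm_pow_pow {q : ℂ} (hq0 : q ≠ 0) (a b : ℕ) (n : ℤ) :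
    thetaTerm (q ^ a) (q ^ b) n = (-1) ^ n * q ^ (a * Ring.choose n 2 + b * n) := by
  rw [thetaTerm, zpow_add₀ hq0, zpow_mul, zpow_mul, zpow_natCast, zpow_natCast, mul_assoc]

lemma thetaTerm_pow_three {q : ℂ} (hq0 : q ≠ 0) (n : ℤ) :
    thetaTerm (q ^ 3) (-q ^ 2) n = q ^ (3 * Ring.choose n 2 + 2 * n) := by
  have h : (-1 : ℂ) ^ n * (-1) ^ n = 1 := by rw [← mul_zpow]; simp
  rw [thetaTerm, zpow_add₀ hq0, zpow_mul, zpow_mul, neg_eq_neg_one_mul (q ^ 2), mul_zpow]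
  linear_combination (norm := skip) ((q ^ 3) ^ Ring.choose n 2 * (q ^ 2) ^ n) * h
  norm_cast
  ring

lemma neg_one_zpow_mul_zpow_congr {q : ℂ} {s s' e e' : ℤ} (t : ℤ) (hs : s = s' + 2 * t)
    (he : e = e') : (-1 : ℂ) ^ s * q ^ e = (-1) ^ s' * q ^ e' := by
  rw [hs, he, zpow_add₀ (by norm_num), zpow_mul]
  norm_num

lemma neg_one_zpow_mul_zpow_congr_neg {q : ℂ} {s s' e e' : ℤ} (t : ℤ) (hs : s = s' + 2 * t + 1)
    (he : e = e') : (-1 : ℂ) ^ s * q ^ e = -((-1) ^ s' * q ^ e') := by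
  rw [hs, zpow_add_one₀ (by norm_num), ← neg_one_zpow_mul_zpow_congr t rfl he]
  ring

lemma thetaTerm_one_mul_thetaTerm_sq {q : ℂ} (hq0 : q ≠ 0) (n m : ℤ) :
    thetaTerm q 1 n * thetaTerm (q ^ 2) q m = (-1) ^ (n + m) * q ^ (Ring.choose n 2 + m ^ 2) := by
  have h1 := thetaTerm_pow_pow hq0 1 0 n
  have h2 := thetaTerm_pow_pow hq0 2 1 m
  have h3 : (-1 : ℂ) ≠ 0 := by norm_num
  have h4 : m ^ 2 = 2 * Ring.choose m 2 + m := by rw [two_mul_choose_two]; ring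
  simp only [pow_one, pow_zero, Nat.cast_one, Nat.cast_zero, one_mul, zero_mul, add_zero,
    Nat.cast_ofNat] at h1 h2
  rw [h1, h2, h4, zpow_add₀ h3, zpow_add₀ hq0 (Ring.choose n 2)]
  ring

lemma thetaTerm_mul_thetaTerm_neg_three_mul {q : ℂ} (hq0 : q ≠ 0) (l m : ℤ) :
    thetaTerm q 1 (-3 * l - 2 * (m - l)) * thetaTerm (q ^ 2) q (m - l) =
      thetaTerm (q ^ 6) (q ^ 4) m * q ^ (3 * Ring.choose l 2 + 2 * l) := by
  rw [thetaTerm_one_mul_thetaTerm_sq hq0, thetaTerm_pow_pow hq0, mul_assoc, ← zpow_add₀ hq0]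
  refine neg_one_zpow_mul_zpow_congr (-l - m) (by ring) ?_
  have h1 := two_mul_choose_two (-3 * l - 2 * (m - l))
  have h2 := two_mul_choose_two m
  have h3 := two_mul_choose_two l
  push_cast
  linarith

lemma thetaTerm_mul_thetaTerm_three_mul_add_one {q : ℂ} (hq0 : q ≠ 0) (l m : ℤ) :
    thetaTerm q 1 (3 * l + 1 - 2 * (l - m)) * thetaTerm (q ^ 2) q (l - m) =
      -(thetaTerm (q ^ 6) (q ^ 4) m * q ^ (3 * Ring.choose l 2 + 2 * l)) := by
  rw [thetaTerm_one_mul_thetaTerm_sq hq0, thetaTerm_pow_pow hq0, mul_assoc, ← zpow_add₀ hq0]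
  refine neg_one_zpow_mul_zpow_congr_neg l (by ring) ?_
  have h1 := two_mul_choose_two (3 * l + 1 - 2 * (l - m))
  have h2 := two_mul_choose_two m
  have h3 := two_mul_choose_two l
  push_cast
  linarith

lemma thetaTerm_mul_thetaTerm_three_mul_add_two {q : ℂ} (hq0 : q ≠ 0) (l m : ℤ) :
    thetaTerm q 1 (3 * l + 2 - 2 * (2 * l + 1 - m)) * thetaTerm (q ^ 2) q (2 * l + 1 - m) =
      -(thetaTerm q 1 (3 * l + 2 - 2 * m) * thetaTerm (q ^ 2) q m) := by
  rw [thetaTerm_one_mul_thetaTerm_sq hq0, thetaTerm_one_mul_thetaTerm_sq hq0]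
  refine neg_one_zpow_mul_zpow_congr_neg (m - l - 1) (by ring) ?_
  have h1 := two_mul_choose_two (3 * l + 2 - 2 * (2 * l + 1 - m))
  have h2 := two_mul_choose_two (3 * l + 2 - 2 * m)
  linarith

/-! ### The product of two theta series -/

/-- The coefficient of `z ^ k` in the product of the theta series with general terms
`thetaTerm q z n` and `thetaTerm (q ^ 2) (q * z ^ 2) m`. -/
noncomputable def thetaConv (q : ℂ) (k : ℤ) : ℂ :=
  ∑' m : ℤ, thetaTerm q 1 (k - 2 * m) * thetaTerm (q ^ 2) q m

lemma thetaConv_neg_three_mul {q : ℂ} (hq0 : q ≠ 0) (l : ℤ) :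
    thetaConv q (-3 * l) =
      (∑' m, thetaTerm (q ^ 6) (q ^ 4) m) * q ^ (3 * Ring.choose l 2 + 2 * l) := by
  rw [thetaConv, ← (Equiv.subRight l).tsum_eq, ← tsum_mul_right]
  exact tsum_congr fun m => thetaTerm_mul_thetaTerm_neg_three_mul hq0 l m

lemma thetaConv_three_mul_add_one {q : ℂ} (hq0 : q ≠ 0) (l : ℤ) :
    thetaConv q (3 * l + 1) =
      -((∑' m, thetaTerm (q ^ 6) (q ^ 4) m) * q ^ (3 * Ring.choose l 2 + 2 * l)) := by
  rw [thetaConv, ← (Equiv.subLeft l).tsum_eq, ← tsum_mul_right, ← tsum_neg]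
  exact tsum_congr fun m => thetaTerm_mul_thetaTerm_three_mul_add_one hq0 l m

/-- The reflection `m ↦ 2 l + 1 - m` changes the sign of the convolution, which is therefore `0`. -/
lemma thetaConv_three_mul_add_two {q : ℂ} (hq0 : q ≠ 0) (l : ℤ) :
    thetaConv q (3 * l + 2) = 0 := by
  have h : thetaConv q (3 * l + 2) = -thetaConv q (3 * l + 2) := by
    conv_lhs => rw [thetaConv, ← (Equiv.subLeft (2 * l + 1)).tsum_eq]
    rw [thetaConv, ← tsum_neg]
    exact tsum_congr fun m => thetaTerm_mul_thetaTerm_three_mul_add_two hq0 l m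
  exact self_eq_neg.mp h

lemma norm_pow_lt_one {q : ℂ} (hq : ‖q‖ < 1) {n : ℕ} (hn : n ≠ 0) : ‖q ^ n‖ < 1 := by
  rw [norm_pow]; exact pow_lt_one₀ (norm_nonneg _) hq hn

/-- The derivative at `z = 1` of the product of the theta series with general terms
`thetaTerm q z n` and `thetaTerm (q ^ 2) (q * z ^ 2) m`, collected by powers of `z`. -/
lemma hasSum_mul_thetaConv {q : ℂ} (hq : ‖q‖ < 1) (hq0 : q ≠ 0) :
    HasSum (fun k : ℤ => (k : ℂ) * thetaConv q k)
      ((∑' n : ℤ, (n : ℂ) * thetaTerm q 1 n) * ∑' m, thetaTerm (q ^ 2) q m) := by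
  have hq2 := norm_pow_lt_one hq two_ne_zero
  have hq02 : q ^ 2 ≠ 0 := pow_ne_zero 2 hq0
  have a0 := summable_norm_thetaTerm hq hq0 one_ne_zero
  have a1 := summable_norm_mul_thetaTerm hq hq0 one_ne_zero
  have b0 := summable_norm_thetaTerm hq2 hq02 hq0
  have b1 := summable_norm_mul_thetaTerm hq2 hq02 hq0
  have h1 := (summable_mul_of_summable_norm a1 b0).hasSum
  have h2 := (summable_mul_of_summable_norm a0 b1).hasSum
  rw [← tsum_mul_tsum_of_summable_norm a1 b0] at h1
  rw [← tsum_mul_tsum_of_summable_norm a0 b1, tsum_thetaTerm_one hq hq0, zero_mul] at h2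
  let e : ℤ × ℤ ≃ ℤ × ℤ :=
    { toFun := fun p => (p.1 - 2 * p.2, p.2)
      invFun := fun p => (p.1 + 2 * p.2, p.2)
      left_inv := fun p => by simp
      right_inv := fun p => by simp }
  have h3 := e.hasSum_iff.mpr (h1.add (h2.mul_left 2))
  have h4 : HasSum (fun p : ℤ × ℤ =>
      (p.1 : ℂ) * (thetaTerm q 1 (p.1 - 2 * p.2) * thetaTerm (q ^ 2) q p.2))
      ((∑' n : ℤ, (n : ℂ) * thetaTerm q 1 n) * ∑' m, thetaTerm (q ^ 2) q m) := by
    refine h3.congr_of_eq (fun p => ?_) (by ring)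
    simp only [e, Function.comp, Equiv.coe_fn_mk]
    push_cast
    ring
  refine h4.prod_fiberwise fun k => ?_
  rw [thetaConv, ← tsum_mul_left]
  exact (h4.summable.prod_factor k).hasSum

lemma tsum_eq_tsum_mod_three {f : ℤ → ℂ} (hf : Summable f) :
    ∑' k, f k = ∑' l : ℤ, f (-3 * l) + ∑' l : ℤ, f (3 * l + 1) + ∑' l : ℤ, f (3 * l + 2) := by
  have inj (c : ℤ) : Function.Injective fun l : ℤ => 3 * l + c := fun x y h => by
    simp only at h; lia
  have s (c : ℤ) : Summable fun l : ℤ => f (3 * l + c) := hf.comp_injective (inj c)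
  have h0 : ∑' l : ℤ, f (-3 * l) = ∑' l : ℤ, f (3 * l + 0) := by
    rw [← (Equiv.neg ℤ).tsum_eq]
    exact tsum_congr fun l => by simp
  have hs := (Int.divModEquiv 3).symm.summable_iff.mpr hf
  rw [h0, ← (s 0).tsum_add (s 1), ← ((s 0).add (s 1)).tsum_add (s 2),
    ← (Int.divModEquiv 3).symm.tsum_eq f]
  refine (hs.tsum_prod).trans (tsum_congr fun l => ?_)
  rw [tsum_fintype, Fin.sum_univ_three]
  simp [Int.divModEquiv, mul_comm]

/-! ### Products -/

lemma qFactorialInf_trisection {p : ℂ} (hp : ‖p‖ < 1) :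
    qFactorialInf p p =
      qFactorialInf (p ^ 3) (p ^ 3) * qFactorialInf (p ^ 2) (p ^ 3) * qFactorialInf p (p ^ 3) := by
  have hp3 := norm_pow_lt_one hp three_ne_zero
  have h (n : ℕ) : qFactorialFin p p (3 * n) =
      qFactorialFin (p ^ 3) (p ^ 3) n * qFactorialFin (p ^ 2) (p ^ 3) n *
        qFactorialFin p (p ^ 3) n := by
    induction n with
    | zero => simp
    | succ n ih =>
      simp only [mul_add, mul_one, qFactorialFin_succ, ih, show 3 * n + 3 = 3 * n + 1 + 1 + 1 by rfl]
      ring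
  have h1 : Tendsto (fun n : ℕ => 3 * n) atTop atTop :=
    tendsto_atTop_mono (fun n => Nat.le_mul_of_pos_left n three_pos) tendsto_id
  refine tendsto_nhds_unique ((tendsto_qFactorialFin p hp).comp h1) ?_
  exact (((tendsto_qFactorialFin (p ^ 3) hp3).mul (tendsto_qFactorialFin (p ^ 2) hp3)).mul
    (tendsto_qFactorialFin p hp3)).congr fun n => (h n).symm

lemma tsum_thetaTerm_pow_six {q : ℂ} (hq : ‖q‖ < 1) (hq0 : q ≠ 0) :
    ∑' m, thetaTerm (q ^ 6) (q ^ 4) m = qFactorialInf (q ^ 2) (q ^ 2) := by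
  rw [tsum_thetaTerm (norm_pow_lt_one hq (by norm_num)) (pow_ne_zero _ hq0) (pow_ne_zero _ hq0),
    qFactorialInf_trisection (norm_pow_lt_one hq two_ne_zero)]
  have h : q ^ 6 / q ^ 4 = q ^ 2 := by field_simp
  rw [h]
  norm_num [← pow_mul]

/-! ### The two evaluations -/

/-- The derivative at `z = 1` of the quintuple product identity. -/
theorem tsum_six_mul_add_one_mul_zpow {q : ℂ} (hq : ‖q‖ < 1) (hq0 : q ≠ 0) :
    ∑' l : ℤ, (6 * (l : ℂ) + 1) * q ^ (3 * Ring.choose l 2 + 2 * l) =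
      qFactorialInf q q ^ 3 * qFactorialInf q (q ^ 2) ^ 2 := by
  have hq2 := norm_pow_lt_one hq two_ne_zero
  have hP := qFactorialInf_ne_zero hq2 hq2
  have h := hasSum_mul_thetaConv hq hq0
  have inj (c : ℤ) : Function.Injective fun l : ℤ => 3 * l + c := fun x y h => by
    simp only at h; lia
  have inj' : Function.Injective fun l : ℤ => -3 * l := fun x y h => by
    simp only at h; lia
  have s0 := h.summable.comp_injective inj'
  have s1 := h.summable.comp_injective (inj 1)
  have h1 := h.tsum_eq
  rw [tsum_eq_tsum_mod_three h.summable, tsum_mul_thetaTerm_one hq hq0,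
    tsum_thetaTerm hq2 (pow_ne_zero 2 hq0) hq0, show q ^ 2 / q = q by field_simp] at h1
  simp only [Function.comp_def, thetaConv_neg_three_mul hq0, thetaConv_three_mul_add_one hq0,
    thetaConv_three_mul_add_two hq0, tsum_thetaTerm_pow_six hq hq0, mul_zero, tsum_zero,
    add_zero] at h1 s0 s1
  -- The classes `k = -3 l` and `k = 3 l + 1` contribute `-3 l` and `-(3 l + 1)`: in all `-(6 l + 1)`.
  rw [← s0.tsum_add s1] at h1
  refine mul_left_cancel₀ (neg_ne_zero.mpr hP) ?_
  rw [← tsum_mul_left]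
  refine (tsum_congr fun l => ?_).trans (h1.trans (by ring))
  push_cast
  ring

theorem mainTheorem4 (q : ℂ) (hq : ‖q‖ < 1) :
    Summable (fun n : ℤ => (n : ℂ) * q ^ (3 * Ring.choose n 2 + 2 * n)) ∧
      6 * ∑' n : ℤ, (n : ℂ) * q ^ (3 * Ring.choose n 2 + 2 * n) =
        qFactorialInf q q ^ 3 * qFactorialInf q (q ^ 2) ^ 2
          - qMultiFactorialInf ![-q, -q ^ 2, q ^ 3] (q ^ 3) := by
  rcases eq_or_ne q 0 with rfl | hq0
  -- Every term vanishes, since the exponent `n (3 n + 1) / 2` is `0` only for `n = 0`.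
  · have h (n : ℤ) : (n : ℂ) * 0 ^ (3 * Ring.choose n 2 + 2 * n) = 0 := by
      rcases eq_or_ne n 0 with rfl | hn
      · simp
      · have h1 := two_mul_choose_two n
        have h2 : n * (3 * n + 1) ≠ 0 := mul_ne_zero hn (by lia)
        rw [zero_zpow _ fun h3 => h2 (by linarith), mul_zero]
    simp only [h]
    exact ⟨summable_zero, by simp [qMultiFactorialInf, qFactorialInf, Fin.prod_univ_three]⟩
  have hq3 := norm_pow_lt_one hq three_ne_zero
  have hq03 := pow_ne_zero 3 hq0
  have hz : -q ^ 2 ≠ 0 := neg_ne_zero.mpr (pow_ne_zero 2 hq0)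
  have s0 := (summable_norm_thetaTerm hq3 hq03 hz).of_norm.congr fun n => thetaTerm_pow_three hq0 n
  have s1 := (summable_norm_mul_thetaTerm hq3 hq03 hz).of_norm
  have h := tsum_thetaTerm hq3 hq03 hz
  rw [show q ^ 3 / -q ^ 2 = -q by field_simp] at h
  simp only [thetaTerm_pow_three hq0] at s1 h
  refine ⟨s1, ?_⟩
  have h6 := tsum_six_mul_add_one_mul_zpow hq hq0
  simp only [add_mul, one_mul, mul_assoc] at h6
  rw [(s1.mul_left 6).tsum_add s0, tsum_mul_left, h] at h6
  rw [← h6]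
  simp [qMultiFactorialInf, Fin.prod_univ_three]
  ring
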